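/- Setting. A brick in $E^n=\mathbb R^n$ is $J=\prod_{i=1}^n[a_i,b_i]$ with $a_i<b_i$, and $\mu(J)=\prod_i(b_i-a_i)$; bricks do not overlap if their interiors are disjoint. The coefficient of regularity is $r(J)=\sup\{\mu(J)/\mu(K): K\supseteq J \text{ a cube}\}=\mu(J)d^{-n}$, where $d$ is the longest edge of $J$. A brick $J$ with associated point $P$ is compatible with $\delta(P)>0$ if $P\in J$ and $J$ lies in the open ball with centre $P$ and radius $\delta(P)$. Fix a brick $I$; below $\delta$ ranges over the positive functions on $I$. A division of $I$ is a finite set of non-overlapping bricks with union $I$, each with an associated point; it is compatible with $\delta$ if each of its bricks is. The integral $\int_J f\,d\mu$ is the generalised Riemann (Henstock–Kurzweil) integral. The outer measure of $X$ in $I$ is $$V(\mu;I;X)=\inf_\delta\ \sup_{\mathcal D}\ \sum_{(P,J)\in\mathcal D,\ P\in X}\mu(J),$$ with $\mathcal D$ ranging over the divisions of $I$ compatible with $\delta$; write $\mu^*$ for Lebesgue outer measure. For $\alpha>0$, $X\subseteq I$ and $\delta$, a $(\delta,I)$-compatible $\alpha$-inner cover of $X$ is a set $\mathcal C$ of bricks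 with associated points, each contained in $I$ and compatible with $\delta$, such that each $P\in X$ is the associated point of some $J\in\mathcal C$ with $r(J)\ge\alpha$. Put $$IV_1(\mu;\mathcal C)=\sup\Big\{\sum_{J\in\mathcal S}\mu(J):\mathcal S\subseteq\mathcal C\text{ finite and non-overlapping}\Big\},\qquad IV(\mu;I;X;\alpha)=\sup_\delta\ \inf_{\mathcal C}\ IV_1(\mu;\mathcal C),$$ with $\mathcal C$ ranging over the $(\delta,I)$-compatible $\alpha$-inner covers of $X$ (and $\inf\emptyset=+\infty$). For a function $F$ of bricks $J\subseteq I$ and $P\in I$, write $D(F;\mu;I;P)=D$ if for all $\varepsilon>0$ and $\alpha>0$ there is $\rho>0$ such that $|F(J)/\mu(J)-D|<\varepsilon$ for all bricks $J\subseteq I$ with associated point $P$ that are compatible with $\rho$ and have $r(J)\ge\alpha$. Theorem. Let $f$ be a real- or complex-valued function and let $F(J)=\int_J f\,d\mu$ for all bricks $J\subseteq I$ (all these integrals existing). 1. There are sets $X_\alpha\subseteq I$ $(\alpha>0)$ with $IV(\mu;I;X_\alpha;\alpha)=0$ for all $\alpha>0$, such that $D(F;\mu;I;P)=f(P)$ for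 every $P\in I\setminus\bigcup_{\alpha>0}X_\alpha$, and such that moreover $\mu^*\big(\bigcup_{\alpha>0}X_\alpha\big)=V\big(\mu;I;\bigcup_{\alpha>0}X_\alpha\big)=0$. 2. For every $\alpha>0$ and every $X\subseteq I$, if $IV(\mu;I;X;\alpha)=0$ then $\mu^*(X)=V(\mu;I;X)=0$. 3. Consequently $D(F;\mu;I;P)=f(P)$ for almost every $P\in I$: the set $E$ of the points $P\in I$ at which this fails has $\mu^*(E)=V(\mu;I;E)=0$. -/

import Mathlib

/-!
Bricks in `Eⁿ` are Mathlib's `BoxIntegral.Box (Fin n)`: a pair of corners `lower < upper`. The closed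
brick is `Box.Icc J`, inclusion of closed bricks is `J ≤ I`, and two bricks do not overlap exactly
when the half-open boxes `(J : Set _)` are disjoint. A division of `I` with associated points is a
`TaggedPrepartition I` that is a partition and whose tags lie in their closed bricks.
-/

namespace BrickDiff

open BoxIntegral

/-- Volume of a brick, the product of its edge lengths. -/
noncomputable def vol {n : ℕ} (J : Box (Fin n)) : ℝ :=
  ∏ i, (J.upper i - J.lower i)

/-- All edges have the same length. -/
def IsCube {n : ℕ} (K : Box (Fin n)) : Prop :=
  ∃ c : ℝ, ∀ i, K.upper i - K.lower i = c

/-- Coefficient of regularity: the supremum of `μ(J) / μ(K)` over the cubes `K` that contain `J`. -/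
noncomputable def regularity {n : ℕ} (J : Box (Fin n)) : ℝ :=
  sSup {t : ℝ | ∃ K : Box (Fin n), IsCube K ∧ J ≤ K ∧ t = vol J / vol K}

/-- If `d` is the longest edge of `J`, the coefficient of regularity is `μ(J) / dⁿ`. -/
theorem regularity_eq {n : ℕ} (J : Box (Fin n)) :
    regularity J = vol J / (⨆ i, (J.upper i - J.lower i)) ^ n := by
  have hJ : 0 < vol J := Finset.prod_pos fun i _ => sub_pos.2 (J.lower_lt_upper i)
  have hle : ∀ i, J.upper i - J.lower i ≤ ⨆ i, (J.upper i - J.lower i) := fun i =>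
    le_ciSup (f := fun i => J.upper i - J.lower i) (Set.finite_range _).bddAbove i
  have hd : ∀ _ : Fin n, 0 < ⨆ i, (J.upper i - J.lower i) := fun i =>
    (sub_pos.2 (J.lower_lt_upper i)).trans_le (hle i)
  have hpow : 0 < (⨆ i, (J.upper i - J.lower i)) ^ n := by
    rcases Nat.eq_zero_or_pos n with h | h
    · subst h; simp
    · exact pow_pos (hd ⟨0, h⟩) n
  apply IsGreatest.csSup_eq
  constructor
  · refine ⟨⟨J.lower, fun i => J.lower i + ⨆ i, (J.upper i - J.lower i), fun i => ?_⟩,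
      ⟨⨆ i, (J.upper i - J.lower i), fun i => ?_⟩, ?_, ?_⟩
    · linarith [hd i]
    · simp
    · rw [Box.le_iff_bounds]
      refine ⟨le_rfl, fun i => ?_⟩
      have := hle i
      simp only
      linarith
    · simp [vol]
  · rintro t ⟨K, ⟨c, hc⟩, hJK, rfl⟩
    rw [Box.le_iff_bounds] at hJK
    have hK : vol K = c ^ n := by simp [vol, hc]
    rw [hK]
    apply div_le_div_of_nonneg_left hJ.le hpow
    rcases Nat.eq_zero_or_pos n with h | h
    · subst h; simp
    · have : Nonempty (Fin n) := ⟨⟨0, h⟩⟩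
      refine pow_le_pow_left₀ (hd ⟨0, h⟩).le (ciSup_le fun i => ?_) n
      have h1 := hJK.1 i
      have h2 := hJK.2 i
      rw [← hc i]
      linarith

/-- The brick `J` with associated point `P` is compatible with the number `ρ`: `P` lies in the
closed brick and the closed brick lies in the open Euclidean ball of centre `P` and radius `ρ`. -/
def Compatible {n : ℕ} (ρ : ℝ) (P : Fin n → ℝ) (J : Box (Fin n)) : Prop :=
  P ∈ Box.Icc J ∧ ∀ Q ∈ Box.Icc J, ∑ i, (Q i - P i) ^ 2 < ρ ^ 2

/-- A positive function on the closed brick `I`. -/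
def IsGauge {n : ℕ} (I : Box (Fin n)) (δ : (Fin n → ℝ) → ℝ) : Prop :=
  ∀ P ∈ Box.Icc I, 0 < δ P

/-- A division of `I` with associated points, compatible with `δ`. -/
def IsDivision {n : ℕ} {I : Box (Fin n)} (δ : (Fin n → ℝ) → ℝ) (π : TaggedPrepartition I) : Prop :=
  π.IsPartition ∧ ∀ J ∈ π, Compatible (δ (π.tag J)) (π.tag J) J

open Classical in
/-- The outer measure `V(μ; I; X)` of `X` in `I`: the infimum over the gauges `δ` of the supremum,
over the `δ`-compatible divisions of `I`, of the total volume of the bricks whose associated point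
is in `X`. -/
noncomputable def outerVariation {n : ℕ} (I : Box (Fin n)) (X : Set (Fin n → ℝ)) : ENNReal :=
  ⨅ (δ : (Fin n → ℝ) → ℝ) (_ : IsGauge I δ),
    ⨆ (π : TaggedPrepartition I) (_ : IsDivision δ π),
      ∑ J ∈ π.boxes, if π.tag J ∈ X then ENNReal.ofReal (vol J) else 0

/-- A set of bricks with associated points is an `α`-inner cover of `X`, compatible with `δ` and
`I`. -/
structure IsInnerCover {n : ℕ} (I : Box (Fin n)) (δ : (Fin n → ℝ) → ℝ) (α : ℝ)
    (X : Set (Fin n → ℝ)) (C : Set (Box (Fin n) × (Fin n → ℝ))) : Prop where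
  subset : ∀ p ∈ C, p.1 ≤ I
  compatible : ∀ p ∈ C, Compatible (δ p.2) p.2 p.1
  covers : ∀ P ∈ X, ∃ J, (J, P) ∈ C ∧ α ≤ regularity J

/-- `IV₁(μ; C)`: the supremum of the total volumes of the finite non-overlapping collections of
bricks of `C`. -/
noncomputable def innerSup {n : ℕ} (C : Set (Box (Fin n) × (Fin n → ℝ))) : ENNReal :=
  ⨆ (s : Finset (Box (Fin n))) (_ : ∀ J ∈ s, ∃ P, (J, P) ∈ C)
    (_ : (s : Set (Box (Fin n))).Pairwise
      fun J K => Disjoint (J : Set (Fin n → ℝ)) (K : Set (Fin n → ℝ))),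
    ∑ J ∈ s, ENNReal.ofReal (vol J)

/-- The `α`-inner variation `IV(μ; I; X; α)`: the supremum over the gauges `δ` on `I` of the infimum
of `IV₁(μ; C)` over the `α`-inner covers `C` of `X` compatible with `δ` and `I` (the infimum is `∞`
if there is none, as for `X` nonempty and `1 < α`). -/
noncomputable def innerVariation {n : ℕ} (I : Box (Fin n)) (X : Set (Fin n → ℝ)) (α : ℝ) :
    ENNReal :=
  ⨆ (δ : (Fin n → ℝ) → ℝ) (_ : IsGauge I δ),
    ⨅ (C : Set (Box (Fin n) × (Fin n → ℝ))) (_ : IsInnerCover I δ α X C), innerSup C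

/-- `D` is the derivative of the brick function `F` with respect to volume and `I` at `P`. -/
def HasBrickDeriv {n : ℕ} {𝕜 : Type*} [RCLike 𝕜] (F : Box (Fin n) → 𝕜) (I : Box (Fin n))
    (P : Fin n → ℝ) (D : 𝕜) : Prop :=
  ∀ ε > (0 : ℝ), ∀ α > (0 : ℝ), ∃ ρ > (0 : ℝ), ∀ J : Box (Fin n), J ≤ I → α ≤ regularity J →
    Compatible ρ P J → ‖F J / ((vol J : ℝ) : 𝕜) - D‖ < ε

end BrickDiff

namespace BrickDiff

open BoxIntegral MeasureTheory Set
open scoped ENNReal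

variable {n : ℕ}

/-! Where the quotients over `α`-regular bricks fail to converge to `f P`, arbitrarily small bricks
have error `‖F J - vol J • f P‖` at least a fixed multiple of `vol J`. Henstock's lemma makes the
sum of such errors over non-overlapping bricks arbitrarily small, so the bad points have inner
variation zero (`innerVariation_exceptionalSet`). Vitali's covering argument bounds Lebesgue outer
measure by inner variation, up to a constant depending on `n` and `α` (`IsInnerCover.volume_le`).
Finally, an open set of small measure around a null set yields a gauge that makes its outer
variation small (`outerVariation_eq_zero`). -/

theorem vol_pos (J : Box (Fin n)) : 0 < vol J :=
  Finset.prod_pos fun i _ => sub_pos.2 (J.lower_lt_upper i)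

theorem volume_coe_box (J : Box (Fin n)) :
    volume (J : Set (Fin n → ℝ)) = ENNReal.ofReal (vol J) := by
  rw [vol, ← Box.volume_apply', ENNReal.ofReal_toReal (J.measure_coe_lt_top volume).ne]

/-- `dist` is the sup metric, which the Euclidean distance dominates. -/
theorem Compatible.dist_lt {ρ : ℝ} (hρ : 0 < ρ) {P Q : Fin n → ℝ} {J : Box (Fin n)}
    (h : Compatible ρ P J) (hQ : Q ∈ Box.Icc J) : dist Q P < ρ := by
  refine (dist_pi_lt_iff hρ).2 fun i => ?_
  rw [Real.dist_eq]
  refine abs_lt_of_sq_lt_sq ?_ hρ.le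
  exact (Finset.single_le_sum (f := fun i => (Q i - P i) ^ 2) (fun i _ => sq_nonneg _)
    (Finset.mem_univ i)).trans_lt (h.2 Q hQ)

theorem Compatible.mono {ρ ρ' : ℝ} (hρ : 0 ≤ ρ) (hle : ρ ≤ ρ') {P : Fin n → ℝ}
    {J : Box (Fin n)} (h : Compatible ρ P J) : Compatible ρ' P J :=
  ⟨h.1, fun Q hQ => (h.2 Q hQ).trans_le (pow_le_pow_left₀ hρ hle 2)⟩

/-- The outer measure `V(μ; I; X)` of a Lebesgue null set is zero. -/
theorem outerVariation_eq_zero (I : Box (Fin n)) {X : Set (Fin n → ℝ)} (hX : volume X = 0) :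
    outerVariation I X = 0 := by
  classical
  refine le_antisymm (le_of_forall_pos_le_add fun ε hε => ?_) bot_le
  rw [zero_add]
  obtain ⟨U, hXU, hU, hUε⟩ := X.exists_isOpen_lt_of_lt ε (hX ▸ hε)
  have hball : ∀ P ∈ X, ∃ δ > 0, Metric.ball P δ ⊆ U := fun P hP =>
    Metric.isOpen_iff.1 hU P (hXU hP)
  choose! δ hδ hδU using hball
  -- Only tags in `X` are counted, so the value off `X` is arbitrary.
  have hg : IsGauge I fun P => if P ∈ X then δ P else 1 := by
    intro P _
    dsimp only
    split_ifs with h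
    exacts [hδ P h, one_pos]
  refine (iInf₂_le _ hg).trans (iSup₂_le fun π hπ => ?_)
  rw [← Finset.sum_filter]
  calc ∑ J ∈ π.boxes with π.tag J ∈ X, ENNReal.ofReal (vol J)
      = volume (⋃ J ∈ π.boxes.filter fun J => π.tag J ∈ X, (J : Set (Fin n → ℝ))) := by
        rw [measure_biUnion_finset _ fun J _ => J.measurableSet_coe]
        · exact Finset.sum_congr rfl fun J _ => (volume_coe_box J).symm
        · exact π.pairwiseDisjoint.mono fun J hJ => (Finset.mem_filter.1 hJ).1
    _ ≤ volume U := by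
        refine measure_mono (iUnion₂_subset fun J hJ Q hQ => ?_)
        obtain ⟨hJ, hJX⟩ := Finset.mem_filter.1 hJ
        have hc := hπ.2 J hJ
        simp only [if_pos hJX] at hc
        exact hδU _ hJX (hc.dist_lt (hδ _ hJX) (Box.coe_subset_Icc hQ))
    _ ≤ ε := hUε.le

/-! ### Longest edges and the Vitali covering estimate -/

theorem edge_le_iSup (J : Box (Fin n)) (i : Fin n) :
    J.upper i - J.lower i ≤ ⨆ i, (J.upper i - J.lower i) :=
  le_ciSup (f := fun i => J.upper i - J.lower i) (Set.finite_range _).bddAbove i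

theorem iSup_edge_nonneg (J : Box (Fin n)) : 0 ≤ ⨆ i, (J.upper i - J.lower i) :=
  Real.iSup_nonneg fun i => (sub_pos.2 (J.lower_lt_upper i)).le

theorem iSup_edge_mono {J K : Box (Fin n)} (h : J ≤ K) :
    ⨆ i, (J.upper i - J.lower i) ≤ ⨆ i, (K.upper i - K.lower i) := by
  refine Real.iSup_le (fun i => le_trans ?_ (edge_le_iSup K i)) (iSup_edge_nonneg K)
  rw [Box.le_iff_bounds] at h
  linarith [h.1 i, h.2 i]

theorem dist_le_iSup_edge {J : Box (Fin n)} {P Q : Fin n → ℝ} (hP : P ∈ Box.Icc J)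
    (hQ : Q ∈ Box.Icc J) : dist P Q ≤ ⨆ i, (J.upper i - J.lower i) :=
  (dist_pi_le_iff (iSup_edge_nonneg J)).2 fun i =>
    (Real.dist_le_of_mem_Icc ⟨hP.1 i, hP.2 i⟩ ⟨hQ.1 i, hQ.2 i⟩).trans (edge_le_iSup J i)

theorem pow_iSup_edge_le_of_le_regularity {J : Box (Fin n)} {α : ℝ} (hα : 0 < α)
    (h : α ≤ regularity J) : (⨆ i, (J.upper i - J.lower i)) ^ n ≤ vol J / α := by
  rw [regularity_eq] at h
  have hpos : 0 < (⨆ i, (J.upper i - J.lower i)) ^ n := by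
    refine (pow_nonneg (iSup_edge_nonneg J) n).lt_of_ne fun h0 => ?_
    rw [← h0, div_zero] at h
    exact absurd h hα.not_ge
  rw [le_div_iff₀ hpos] at h
  rwa [le_div_iff₀ hα, mul_comm]

/-- Vitali covering estimate: an `α`-inner cover of `X` contains non-overlapping bricks whose total
volume is at least a fixed multiple of the outer measure of `X`. -/
theorem IsInnerCover.volume_le {I : Box (Fin n)} {δ : (Fin n → ℝ) → ℝ} {α : ℝ} (hα : 0 < α)
    {X : Set (Fin n → ℝ)} {C : Set (Box (Fin n) × (Fin n → ℝ))} (hC : IsInnerCover I δ α X C) :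
    volume X ≤ ENNReal.ofReal (6 ^ n / α) * innerSup C := by
  obtain ⟨u, hut, hdisj, hu⟩ := Vitali.exists_disjoint_subfamily_covering_enlargement
    (fun J : Box (Fin n) => Box.Icc J) {J | α ≤ regularity J ∧ ∃ P, (J, P) ∈ C}
    (fun J => ⨆ i, (J.upper i - J.lower i)) 2 one_lt_two (fun J _ => iSup_edge_nonneg J)
    (⨆ i, (I.upper i - I.lower i))
    (fun J ⟨_, P, hP⟩ => iSup_edge_mono (hC.subset _ hP)) fun J _ => ⟨_, J.lower_mem_Icc⟩
  have hdisj' : u.PairwiseDisjoint fun J : Box (Fin n) => (J : Set (Fin n → ℝ)) :=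
    hdisj.mono_on fun J _ => Box.coe_subset_Icc
  have hcount : u.Countable := hdisj.countable_of_nonempty_interior fun J _ => by
    rw [Box.Icc_def, ← pi_univ_Icc, interior_pi_set finite_univ]
    simp only [interior_Icc, univ_pi_nonempty_iff]
    exact fun i => nonempty_Ioo.2 (J.lower_lt_upper i)
  -- The factor 3 is 2 + 1: `J` has longest edge at most twice that of `K`, and `K` itself adds one
  -- more. In the sup metric this ball is a cube of edge 6 times the longest edge of `K`, whence `6
  -- ^ n`.
  have hcover : X ⊆ ⋃ K ∈ u, Metric.closedBall K.lower (3 * ⨆ i, (K.upper i - K.lower i)) := by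
    intro P hP
    obtain ⟨J, hJC, hJ⟩ := hC.covers P hP
    obtain ⟨K, hK, ⟨Q, hQJ, hQK⟩, hle⟩ := hu J ⟨hJ, P, hJC⟩
    refine mem_biUnion hK (Metric.mem_closedBall.2 ?_)
    have h1 := dist_le_iSup_edge (hC.compatible _ hJC).1 hQJ
    have h2 := dist_le_iSup_edge hQK K.lower_mem_Icc
    simp only at h1
    linarith [dist_triangle P Q K.lower]
  calc volume X
      ≤ ∑' K : u, volume (Metric.closedBall K.1.lower
          (3 * ⨆ i, (K.1.upper i - K.1.lower i))) :=
        (measure_mono hcover).trans (measure_biUnion_le _ hcount _)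
    _ ≤ ∑' K : u, ENNReal.ofReal (6 ^ n / α) * ENNReal.ofReal (vol K.1) := by
        refine ENNReal.tsum_le_tsum fun K => ?_
        have hnn := iSup_edge_nonneg K.1
        rw [Real.volume_pi_closedBall _ (by positivity), ← ENNReal.ofReal_mul (by positivity)]
        refine ENNReal.ofReal_le_ofReal ?_
        have := pow_iSup_edge_le_of_le_regularity hα (hut K.2).1
        calc (2 * (3 * ⨆ i, (K.1.upper i - K.1.lower i))) ^ Fintype.card (Fin n)
            = 6 ^ n * (⨆ i, (K.1.upper i - K.1.lower i)) ^ n := by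
              rw [Fintype.card_fin, ← mul_pow]; ring
          _ ≤ 6 ^ n * (vol K.1 / α) := by gcongr
          _ = 6 ^ n / α * vol K.1 := by ring
    _ ≤ ENNReal.ofReal (6 ^ n / α) * innerSup C := by
        rw [ENNReal.tsum_mul_left, ENNReal.tsum_eq_iSup_sum]
        gcongr
        refine iSup_le fun s => ?_
        have hsu : ∀ J ∈ s.map (Function.Embedding.subtype _), J ∈ u := by
          intro J hJ
          obtain ⟨K, _, rfl⟩ := Finset.mem_map.1 hJ
          exact K.2
        refine le_trans (le_of_eq ?_) (le_iSup_of_le (s.map (Function.Embedding.subtype _))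
          (le_iSup₂_of_le (fun J hJ => (hut (hsu J hJ)).2)
            (hdisj'.subset fun J hJ => hsu J hJ) le_rfl))
        rw [Finset.sum_map]
        rfl

/-- Sets of inner variation zero are Lebesgue null. -/
theorem volume_eq_zero_of_innerVariation {I : Box (Fin n)} {X : Set (Fin n → ℝ)} {α : ℝ}
    (hα : 0 < α) (h : innerVariation I X α = 0) : volume X = 0 := by
  -- The Vitali bound does not involve the gauge, so a single one suffices.
  have hg : IsGauge I fun _ => (1 : ℝ) := fun _ _ => one_pos
  have h1 : ⨅ (C : Set (Box (Fin n) × (Fin n → ℝ)))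
      (_ : IsInnerCover I (fun _ => (1 : ℝ)) α X C), innerSup C = 0 :=
    le_antisymm (h ▸ le_iSup₂_of_le (fun _ => (1 : ℝ)) hg le_rfl) bot_le
  have hK : ENNReal.ofReal (6 ^ n / α) ≠ 0 := (ENNReal.ofReal_pos.2 (by positivity)).ne'
  have h2 : volume X / ENNReal.ofReal (6 ^ n / α) ≤ 0 := by
    rw [← h1]
    exact le_iInf₂ fun C hC =>
      ENNReal.div_le_of_le_mul ((hC.volume_le hα).trans_eq (mul_comm _ _))
  simpa using h2

/-! ### Henstock's lemma and the exceptional set -/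

/-- Split the sum according to the sign of the terms. -/
theorem sum_abs_le_of_forall_subset {ι : Type*} {s : Finset ι} {a : ι → ℝ} {ε : ℝ}
    (h : ∀ t ⊆ s, |∑ i ∈ t, a i| ≤ ε) : ∑ i ∈ s, |a i| ≤ 2 * ε := by
  classical
  have h1 : ∑ i ∈ s with 0 ≤ a i, |a i| ≤ ε := by
    rw [Finset.sum_congr rfl fun i hi => abs_of_nonneg (Finset.mem_filter.1 hi).2]
    exact (le_abs_self _).trans (h _ (Finset.filter_subset _ _))
  have h2 : ∑ i ∈ s with ¬ 0 ≤ a i, |a i| ≤ ε := by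
    rw [Finset.sum_congr rfl fun i hi =>
      abs_of_nonpos (not_le.1 (Finset.mem_filter.1 hi).2).le, Finset.sum_neg_distrib]
    exact (neg_le_abs _).trans (h _ (Finset.filter_subset _ _))
  rw [← Finset.sum_filter_add_sum_filter_not s fun i => 0 ≤ a i]
  linarith

theorem sum_norm_le_of_forall_subset {ι 𝕜 : Type*} [RCLike 𝕜] {s : Finset ι} {a : ι → 𝕜} {ε : ℝ}
    (h : ∀ t ⊆ s, ‖∑ i ∈ t, a i‖ ≤ ε) : ∑ i ∈ s, ‖a i‖ ≤ 4 * ε := by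
  have hre : ∑ i ∈ s, |RCLike.re (a i)| ≤ 2 * ε := sum_abs_le_of_forall_subset fun t ht => by
    rw [← map_sum]
    exact (RCLike.abs_re_le_norm _).trans (h t ht)
  have him : ∑ i ∈ s, |RCLike.im (a i)| ≤ 2 * ε := sum_abs_le_of_forall_subset fun t ht => by
    rw [← map_sum]
    exact (RCLike.abs_im_le_norm _).trans (h t ht)
  calc ∑ i ∈ s, ‖a i‖ ≤ ∑ i ∈ s, (|RCLike.re (a i)| + |RCLike.im (a i)|) :=
        Finset.sum_le_sum fun i _ => by
          rw [← Real.sqrt_sq (norm_nonneg (a i)), RCLike.norm_sq_eq_def]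
          refine Real.sqrt_le_iff.2 ⟨by positivity, ?_⟩
          nlinarith [sq_abs (RCLike.re (a i)), sq_abs (RCLike.im (a i)),
            mul_nonneg (abs_nonneg (RCLike.re (a i))) (abs_nonneg (RCLike.im (a i)))]
    _ ≤ 4 * ε := by rw [Finset.sum_add_distrib]; linarith

section Henstock

variable {𝕜 : Type*} [RCLike 𝕜] {I : Box (Fin n)} {f : (Fin n → ℝ) → 𝕜} {F : Box (Fin n) → 𝕜}

/-- Henstock's lemma with the norms inside the sum. -/
theorem exists_gauge_sum_norm_sub_le
    (hF : ∀ J ≤ I, HasIntegral J IntegrationParams.Henstock f BoxAdditiveMap.volume (F J))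
    {ε : ℝ} (hε : 0 < ε) :
    ∃ δ : (Fin n → ℝ) → ℝ, (∀ P, 0 < δ P) ∧
      ∀ (s : Finset (Box (Fin n))) (t : Box (Fin n) → Fin n → ℝ), (∀ J ∈ s, J ≤ I) →
        (s : Set (Box (Fin n))).Pairwise
          (fun J K => Disjoint (J : Set (Fin n → ℝ)) (K : Set (Fin n → ℝ))) →
        (∀ J ∈ s, Compatible (δ (t J)) (t J) J) →
        ∑ J ∈ s, ‖F J - vol J • f (t J)‖ ≤ ε := by
  classical
  have hI : Integrable I IntegrationParams.Henstock f BoxAdditiveMap.volume :=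
    (hF I le_rfl).integrable
  -- The `ε / 4` pays for two signs in each of the real and imaginary parts.
  refine ⟨fun P => hI.convergenceR (ε / 4) 0 P, fun P => (hI.convergenceR (ε / 4) 0 P).2,
    fun s t hsI hdisj hcomp => ?_⟩
  rw [← mul_div_cancel₀ ε (four_ne_zero (α := ℝ))]
  refine sum_norm_le_of_forall_subset fun s' hs' => ?_
  let π : TaggedPrepartition I :=
    { boxes := s'
      le_of_mem' := fun J hJ => hsI J (hs' hJ)
      pairwiseDisjoint := hdisj.mono (Finset.coe_subset.2 hs')
      tag := fun J => if J ∈ s' then t J else I.lower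
      tag_mem_Icc := fun J => by
        split_ifs with h
        · exact Box.le_iff_Icc.1 (hsI J (hs' h)) (hcomp J (hs' h)).1
        · exact I.lower_mem_Icc }
  have htag : ∀ J ∈ s', π.tag J = t J := fun J hJ => if_pos hJ
  have hπ : IntegrationParams.Henstock.MemBaseSet I 0 (hI.convergenceR (ε / 4) 0) π :=
    { isSubordinate := fun J hJ Q hQ => by
        have hc := hcomp J (hs' hJ)
        rw [htag J hJ]
        exact Metric.mem_closedBall.2
          (hc.dist_lt (hI.convergenceR (ε / 4) 0 (t J)).2 hQ).le
      isHenstock := fun _ J hJ => by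
        rw [htag J hJ]
        exact (hcomp J (hs' hJ)).1
      -- Both remaining conditions apply only to integrals that control distortion, which `Henstock`
      -- does not.
      distortion_le := fun h => nomatch h
      exists_compl := fun h => nomatch h }
  have := hI.dist_integralSum_sum_integral_le_of_memBaseSet (by positivity) hπ
  rw [dist_comm, dist_eq_norm, integralSum, ← Finset.sum_sub_distrib] at this
  refine le_trans (le_of_eq (congrArg _ (Finset.sum_congr rfl fun J hJ => ?_))) this
  rw [(hF J (hsI J (hs' hJ))).integral_eq, htag J hJ, BoxAdditiveMap.volume_apply, vol]

/-- The points of `I` at which the quotients `F(J) / μ(J)` over bricks of regularity at least `α` do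
not converge to `f`. -/
def exceptionalSet (F : Box (Fin n) → 𝕜) (f : (Fin n → ℝ) → 𝕜) (I : Box (Fin n)) (α : ℝ) :
    Set (Fin n → ℝ) :=
  {P | P ∈ Box.Icc I ∧ ∃ ε > (0 : ℝ), ∀ ρ > (0 : ℝ), ∃ J ≤ I, α ≤ regularity J ∧
    Compatible ρ P J ∧ ε ≤ ‖F J / ((vol J : ℝ) : 𝕜) - f P‖}

theorem exceptionalSet_anti {α β : ℝ} (h : α ≤ β) :
    exceptionalSet F f I β ⊆ exceptionalSet F f I α := by
  rintro P ⟨hP, ε, hε, H⟩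
  refine ⟨hP, ε, hε, fun ρ hρ => ?_⟩
  obtain ⟨J, hJ, hβ, hJ'⟩ := H ρ hρ
  exact ⟨J, hJ, h.trans hβ, hJ'⟩

theorem hasBrickDeriv_of_notMem_exceptionalSet {P : Fin n → ℝ} (hP : P ∈ Box.Icc I)
    (h : P ∉ ⋃ α ∈ Ioi (0 : ℝ), exceptionalSet F f I α) : HasBrickDeriv F I P (f P) := by
  intro ε hε α hα
  by_contra! H
  exact h (mem_biUnion (mem_Ioi.2 hα) ⟨hP, ε, hε, H⟩)

theorem innerVariation_exceptionalSet
    (hF : ∀ J ≤ I, HasIntegral J IntegrationParams.Henstock f BoxAdditiveMap.volume (F J))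
    (α : ℝ) : innerVariation I (exceptionalSet F f I α) α = 0 := by
  classical
  refine le_antisymm (iSup₂_le fun δ hδ => le_of_forall_pos_le_add fun ε hε => ?_) bot_le
  rw [zero_add]
  obtain ⟨η, hη, hηsum⟩ := ENNReal.exists_pos_sum_of_countable hε.ne' ℕ
  -- Bad points are sorted by a `k` such that the failure of convergence exceeds `1 / (k + 1)`.
  -- Tolerance `η k / (k + 1)` then bounds the volume in class `k` by `η k`, and these sum to less
  -- than `ε`.
  have hgauge := fun k : ℕ =>
    exists_gauge_sum_norm_sub_le hF (ε := η k / (k + 1)) (by have := hη k; positivity)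
  choose γ hγ hsum using hgauge
  have hbad : ∀ P ∈ exceptionalSet F f I α, ∃ (k : ℕ) (J : Box (Fin n)), J ≤ I ∧
      α ≤ regularity J ∧ Compatible (min (δ P) (γ k P)) P J ∧
      vol J / (k + 1) ≤ ‖F J - vol J • f P‖ := by
    rintro P ⟨hP, e, he, H⟩
    obtain ⟨k, hk⟩ := exists_nat_one_div_lt he
    obtain ⟨J, hJ, hα, hc, hn⟩ := H (min (δ P) (γ k P)) (lt_min (hδ P hP) (hγ k P))
    refine ⟨k, J, hJ, hα, hc, ?_⟩
    have hv := vol_pos J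
    have hv' : ((vol J : ℝ) : 𝕜) ≠ 0 := RCLike.ofReal_ne_zero.2 hv.ne'
    have hfac : F J - vol J • f P = (vol J : 𝕜) * (F J / (vol J : 𝕜) - f P) := by
      rw [RCLike.real_smul_eq_coe_mul, mul_sub, mul_div_cancel₀ _ hv']
    rw [hfac, norm_mul, RCLike.norm_ofReal, abs_of_pos hv, div_eq_mul_one_div]
    exact mul_le_mul_of_nonneg_left (hk.le.trans hn) hv.le
  choose! κ B hBI hBα hBc hBn using hbad
  have hcover : IsInnerCover I δ α (exceptionalSet F f I α)
      ((fun P => (B P, P)) '' exceptionalSet F f I α) := by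
    refine ⟨?_, ?_, ?_⟩
    · rintro _ ⟨P, hP, rfl⟩
      exact hBI P hP
    · rintro _ ⟨P, hP, rfl⟩
      exact (hBc P hP).mono (lt_min (hδ P hP.1) (hγ _ P)).le (min_le_left _ _)
    · exact fun P hP => ⟨B P, mem_image_of_mem _ hP, hBα P hP⟩
  refine (iInf₂_le _ hcover).trans (iSup_le fun s => iSup₂_le fun hs hdisj => ?_)
  -- Distinct points may share a brick; one tag per brick is chosen, and its `κ` fixes the class of
  -- the brick.
  have hs' : ∀ J ∈ s, ∃ P ∈ exceptionalSet F f I α, B P = J := by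
    intro J hJ
    obtain ⟨P, Q, hQ, h⟩ := hs J hJ
    exact ⟨Q, hQ, congrArg Prod.fst h⟩
  choose! t htX htB using hs'
  have hfib : ∀ k, ∑ J ∈ s with κ (t J) = k, ENNReal.ofReal (vol J) ≤ η k := by
    intro k
    rw [← ENNReal.ofReal_sum_of_nonneg fun J _ => (vol_pos J).le]
    refine ENNReal.ofReal_le_of_le_toReal ?_
    have hk := hsum k (s.filter fun J => κ (t J) = k) t
      (fun J hJ => by
        have hJs := (Finset.mem_filter.1 hJ).1
        simpa only [htB J hJs] using hBI _ (htX J hJs))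
      (hdisj.mono (Finset.coe_subset.2 (Finset.filter_subset _ _)))
      (fun J hJ => by
        obtain ⟨hJs, rfl⟩ := Finset.mem_filter.1 hJ
        have hc := (hBc _ (htX J hJs)).mono (lt_min (hδ _ (htX J hJs).1) (hγ _ _)).le
          (min_le_right _ _)
        rwa [htB J hJs] at hc)
    have hle : ∑ J ∈ s with κ (t J) = k, vol J / (k + 1) ≤ η k / (k + 1) := by
      refine (Finset.sum_le_sum fun J hJ => ?_).trans hk
      obtain ⟨hJs, rfl⟩ := Finset.mem_filter.1 hJ
      simpa only [htB J hJs] using hBn _ (htX J hJs)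
    rw [← Finset.sum_div] at hle
    exact (div_le_div_iff_of_pos_right (by positivity)).1 hle
  calc ∑ J ∈ s, ENNReal.ofReal (vol J)
      = ∑ k ∈ s.image fun J => κ (t J), ∑ J ∈ s with κ (t J) = k, ENNReal.ofReal (vol J) :=
        (Finset.sum_fiberwise_of_maps_to (fun J hJ => Finset.mem_image_of_mem _ hJ) _).symm
    _ ≤ ∑ k ∈ s.image fun J => κ (t J), (η k : ℝ≥0∞) := Finset.sum_le_sum fun k _ => hfib k
    _ ≤ ε := (ENNReal.sum_le_tsum _).trans hηsum.le

/-- The exceptional sets grow as `α` decreases, so the values `1 / (k + 1)` suffice and the union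
becomes countable. -/
theorem volume_iUnion_exceptionalSet
    (hF : ∀ J ≤ I, HasIntegral J IntegrationParams.Henstock f BoxAdditiveMap.volume (F J)) :
    volume (⋃ α ∈ Ioi (0 : ℝ), exceptionalSet F f I α) = 0 := by
  refine measure_mono_null (t := ⋃ k : ℕ, exceptionalSet F f I (1 / ((k : ℝ) + 1))) ?_ ?_
  · refine iUnion₂_subset fun α hα => ?_
    obtain ⟨k, hk⟩ := exists_nat_one_div_lt (mem_Ioi.1 hα)
    exact (exceptionalSet_anti hk.le).trans
      (subset_iUnion (fun k : ℕ => exceptionalSet F f I (1 / ((k : ℝ) + 1))) k)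
  · exact measure_iUnion_null fun k => volume_eq_zero_of_innerVariation (by positivity)
      (innerVariation_exceptionalSet hF _)

end Henstock

end BrickDiff

theorem mainTheorem6 {n : ℕ} {𝕜 : Type*} [RCLike 𝕜] (I : BoxIntegral.Box (Fin n))
    (f : (Fin n → ℝ) → 𝕜) (F : BoxIntegral.Box (Fin n) → 𝕜)
    (hF : ∀ J ≤ I, BoxIntegral.HasIntegral J BoxIntegral.IntegrationParams.Henstock f
      BoxIntegral.BoxAdditiveMap.volume (F J)) :
    -- the exceptional set, described by inner variation, which has outer measure zero
    (∃ X : ℝ → Set (Fin n → ℝ),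
      (∀ α > 0, X α ⊆ BoxIntegral.Box.Icc I ∧ BrickDiff.innerVariation I (X α) α = 0) ∧
      (∀ P ∈ BoxIntegral.Box.Icc I, P ∉ ⋃ α ∈ Set.Ioi (0 : ℝ), X α →
        BrickDiff.HasBrickDeriv F I P (f P)) ∧
      BrickDiff.outerVariation I (⋃ α ∈ Set.Ioi (0 : ℝ), X α) = 0 ∧
      MeasureTheory.volume (⋃ α ∈ Set.Ioi (0 : ℝ), X α) = 0) ∧
    -- sets of inner variation zero have outer measure zero
    (∀ (X : Set (Fin n → ℝ)) (α : ℝ), X ⊆ BoxIntegral.Box.Icc I → 0 < α →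
      BrickDiff.innerVariation I X α = 0 →
        MeasureTheory.volume X = 0 ∧ BrickDiff.outerVariation I X = 0) ∧
    -- `F` has derivative `f` almost everywhere in `I`
    (BrickDiff.outerVariation I
        {P | P ∈ BoxIntegral.Box.Icc I ∧ ¬ BrickDiff.HasBrickDeriv F I P (f P)} = 0 ∧
      MeasureTheory.volume
        {P | P ∈ BoxIntegral.Box.Icc I ∧ ¬ BrickDiff.HasBrickDeriv F I P (f P)} = 0) := by
  have hnull := BrickDiff.volume_iUnion_exceptionalSet hF
  have hE : MeasureTheory.volume
      {P | P ∈ BoxIntegral.Box.Icc I ∧ ¬ BrickDiff.HasBrickDeriv F I P (f P)} = 0 :=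
    MeasureTheory.measure_mono_null (fun P hP => by_contra fun h =>
      hP.2 (BrickDiff.hasBrickDeriv_of_notMem_exceptionalSet hP.1 h)) hnull
  refine ⟨⟨BrickDiff.exceptionalSet F f I,
      fun α _ => ⟨fun P hP => hP.1, BrickDiff.innerVariation_exceptionalSet hF α⟩,
      fun P hP h => BrickDiff.hasBrickDeriv_of_notMem_exceptionalSet hP h,
      BrickDiff.outerVariation_eq_zero I hnull, hnull⟩,
    fun X α _ hα h => ?_, BrickDiff.outerVariation_eq_zero I hE, hE⟩
  have hX := BrickDiff.volume_eq_zero_of_innerVariation hα h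
  exact ⟨hX, BrickDiff.outerVariation_eq_zero I hX⟩
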